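/- Lemma 31. A $3$-dimensional VASS $V=(Q,T)$ consists of a finite set $Q$ of states and a finite set $T\subseteq Q\times\mathbb{Z}^3\times Q$ of transitions. A configuration $q(w)$ is a state $q \in Q$ together with a vector $w\in\mathbb{N}^3$; a transition $(q,v,q')\in T$ induces the step $q(w)\to q'(w+v)$ whenever $w,w+v\in\mathbb{N}^3$; a path is a sequence of consecutive steps, and a configuration is reachable from $s$ if there is a path from $s$ to it. The norm of a vector is the sum of the absolute values of its entries, and the norm of a transition or configuration is the norm of its vector. For a source configuration $s$, $\mathrm{size}(V,s)$ is the sum of the norms of all transitions of $V$, plus the number of transitions, plus the norm of $s$. $V$ is sequential, $V=(V_1)u_1(V_2)u_2\ldots u_{k-1}(V_k)$ with $k \geq 1$, if it is partitioned into strongly connected VASS $V_1,\ldots,V_k$ (the components) with pairwise disjoint state sets and single transitions $u_1,\ldots,u_{k-1}$ (the bridges), where $u_i$ leads from a state of $V_i$ to a state of $V_{i+1}$. A pair $(V,s)$ with $s=p(w)$ is forward-diagonal if $p(w+\Delta)$ is reachable from $p(w)$ in $V$ for some $\Delta\in(\mathbb{N}_{>0})^3$. Let $\mathrm{cone}(V_i)=\{r_1e_1+\ldots+r_ne_n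 \mid r_1,\ldots,r_n\in\mathbb{Q}_{>0}\}$, where $e_1,\ldots,e_n\in\mathbb{Z}^3$ are the effects of the simple cycles of $V_i$ (this is $\{0\}$ if there are none), and let $\mathrm{seqcone}(V)$ be the set of all sums $v_1+\ldots+v_k$ such that $v_i\in\mathrm{cone}(V_i)$ and $v_1+\ldots+v_i\in(\mathbb{Q}_{>0})^3$ for every $i\in\{1,\ldots,k\}$. Let $d(x,S)=\inf\{d(x,y)\mid y\in S\}$, where $d(x,y)$ is the Euclidean distance. There exists a polynomial $P:\mathbb{N}\to\mathbb{N}$, with $P(n)\ge n$ for all $n$ and $P(n)<P(m)$ for all $n<m$, such that for every sequential $3$-dimensional VASS $V=(V_1)u_1\ldots u_{k-1}(V_k)$ (with any number $k$ of components) and every configuration $s$ whose state belongs to the first component $V_1$, if $(V,s)$ is forward-diagonal then $\mathrm{seqcone}(V)$ is nonempty and every configuration $q(w)$ reachable from $s$ in $V$ satisfies $$d(w,\mathrm{seqcone}(V))\le P(\mathrm{size}(V,s)).$$ -/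

import Mathlib

/-- A transition `(q, v, q')` over the state type `σ`, with effect `v ∈ ℤ^d`. -/
@[ext]
structure Transition (d : ℕ) (σ : Type*) where
  src : σ
  eff : Fin d → ℤ
  tgt : σ

/-- A `d`-dimensional vector addition system with states: a finite set of states and a finite
set of transitions between them. -/
structure VASS (d : ℕ) (σ : Type*) where
  states : Finset σ
  trans : Finset (Transition d σ)
  src_mem : ∀ t ∈ trans, t.src ∈ states
  tgt_mem : ∀ t ∈ trans, t.tgt ∈ states

/-- A configuration `q(w)`: a state together with a nonnegative integer vector. -/
@[ext]
structure Config (d : ℕ) (σ : Type*) where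
  state : σ
  vec : Fin d → ℕ

/-- The norm of an integer vector: the sum of absolute values of its entries. -/
def vecNorm {d : ℕ} (v : Fin d → ℤ) : ℕ := ∑ i, (v i).natAbs

/-- The norm of a configuration is the norm of its vector. -/
def Config.norm {d : ℕ} {σ : Type*} (c : Config d σ) : ℕ := vecNorm fun i => (c.vec i : ℤ)

namespace VASS

variable {d : ℕ} {σ : Type*}

/-- The size of a VASS: the sum of norms of its transitions plus the number of transitions. -/
def size (V : VASS d σ) : ℕ := (∑ t ∈ V.trans, vecNorm t.eff) + V.trans.card

/-- The size of a VASS with a source configuration. -/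
def sizeWith (V : VASS d σ) (s : Config d σ) : ℕ := V.size + s.norm

/-- The step `c → c'` induced by the transition `t` of `V`. -/
def Step (V : VASS d σ) (c : Config d σ) (t : Transition d σ) (c' : Config d σ) : Prop :=
  t ∈ V.trans ∧ t.src = c.state ∧ t.tgt = c'.state ∧
    ∀ i, (c'.vec i : ℤ) = (c.vec i : ℤ) + t.eff i

/-- `V.Path c π c'`: firing the sequence of transitions `π` is a path of `V` from `c` to `c'`
(all configurations along the path are nonnegative). -/
inductive Path (V : VASS d σ) : Config d σ → List (Transition d σ) → Config d σ → Prop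
  | nil (c : Config d σ) (hc : c.state ∈ V.states) : Path V c [] c
  | cons {c c' c'' : Config d σ} {t : Transition d σ} {π : List (Transition d σ)}
      (h : V.Step c t c') (hπ : Path V c' π c'') : Path V c (t :: π) c''

/-- `t` is reachable from `s` in `V`. -/
def Reachable (V : VASS d σ) (s t : Config d σ) : Prop := ∃ π, V.Path s π t

/-- The effect of a sequence of transitions. -/
def effect (π : List (Transition d σ)) : Fin d → ℤ := (π.map Transition.eff).sum

/-- `π` is (the sequence of transitions of) a simple cycle of `V`: a nonempty path whose source
and target configurations have the same state, with no other equality of states along it. -/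
def IsSimpleCycle (V : VASS d σ) (π : List (Transition d σ)) : Prop :=
  π ≠ [] ∧ (∃ c c' : Config d σ, c.state = c'.state ∧ V.Path c π c') ∧
    (π.map Transition.src).Nodup

/-- The set of effects of simple cycles of `V`. -/
def simpleCycleEffects (V : VASS d σ) : Set (Fin d → ℤ) :=
  {e | ∃ π, V.IsSimpleCycle π ∧ effect π = e}

theorem Path.mem_trans {V : VASS d σ} {c c' : Config d σ} {π : List (Transition d σ)}
    (h : V.Path c π c') : ∀ t ∈ π, t ∈ V.trans := by
  induction h with
  | nil => simp
  | cons h _ ih =>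
    intro t ht
    rcases List.mem_cons.1 ht with rfl | ht
    · exact h.1
    · exact ih t ht

theorem simpleCycleEffects_finite (V : VASS d σ) : V.simpleCycleEffects.Finite := by
  have h := ((List.finite_length_le {t // t ∈ V.trans} V.trans.card).image
    (List.map Subtype.val)).image effect
  refine h.subset ?_
  rintro e ⟨π, ⟨-, ⟨c, c', -, hp⟩, hnd⟩, rfl⟩
  have hm := hp.mem_trans
  refine ⟨π, ⟨π.attachWith _ hm, ?_, by simp⟩, rfl⟩
  have hnd' : (π.attachWith _ hm).Nodup :=
    List.Nodup.of_map Subtype.val (by simpa using hnd.of_map)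
  simpa using hnd'.length_le_card

/-- The rational open cone generated by the effects of simple cycles of `V`: all combinations
of these effects with positive rational coefficients (it is `{0}` if there is no cycle). -/
def cone (V : VASS d σ) : Set (Fin d → ℚ) :=
  {x | ∃ r : (Fin d → ℤ) → ℚ, (∀ e ∈ V.simpleCycleEffects, 0 < r e) ∧
    x = ∑ e ∈ V.simpleCycleEffects_finite.toFinset, r e • (fun i => (e i : ℚ))}

/-- The edges of the state graph of `V`. -/
def Edge (V : VASS d σ) (p q : σ) : Prop := ∃ t ∈ V.trans, t.src = p ∧ t.tgt = q

/-- The state graph of `V` is strongly connected. -/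
def StronglyConnected (V : VASS d σ) : Prop :=
  ∀ p ∈ V.states, ∀ q ∈ V.states, Relation.ReflTransGen V.Edge p q

/-- `(V, s)` is forward-diagonal: `s = p(w)` can reach some `p(w + Δ)` with `Δ` positive on
every coordinate. -/
def ForwardDiagonal (V : VASS d σ) (s : Config d σ) : Prop :=
  ∃ Δ : Fin d → ℕ, (∀ i, 0 < Δ i) ∧ V.Reachable s ⟨s.state, s.vec + Δ⟩

/-- A presentation `V = (V_1) u_1 (V_2) u_2 … u_{k-1} (V_k)` of `V` as a sequential VASS with
`k = m + 1` strongly connected components (here indexed from `0`) and `m` bridges. -/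
structure Sequential (V : VASS d σ) where
  m : ℕ
  comp : Fin (m + 1) → VASS d σ
  bridge : Fin m → Transition d σ
  stronglyConnected : ∀ i, (comp i).StronglyConnected
  disjoint : ∀ i j, i ≠ j → Disjoint (comp i).states (comp j).states
  bridge_src : ∀ i : Fin m, (bridge i).src ∈ (comp i.castSucc).states
  bridge_tgt : ∀ i : Fin m, (bridge i).tgt ∈ (comp i.succ).states
  states_eq : ∀ q, q ∈ V.states ↔ ∃ i, q ∈ (comp i).states
  trans_eq : ∀ t, t ∈ V.trans ↔ (∃ i, t ∈ (comp i).trans) ∨ ∃ i, t = bridge i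

/-- A tuple of vectors is a cascade if all its (nonempty) partial sums are positive on every
coordinate. -/
def IsCascade {k : ℕ} (v : Fin k → Fin d → ℚ) : Prop :=
  ∀ i j, 0 < (∑ l ∈ Finset.Iic i, v l) j

/-- The sequential cone: the set of sums of all cascades whose `i`-th vector belongs to the
cone of the `i`-th component. -/
def Sequential.seqCone {V : VASS d σ} (S : V.Sequential) : Set (Fin d → ℚ) :=
  {x | ∃ v : Fin (S.m + 1) → Fin d → ℚ,
    (∀ i, v i ∈ (S.comp i).cone) ∧ IsCascade v ∧ x = ∑ i, v i}

end VASS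

/-- A rational vector as a point of Euclidean space. -/
noncomputable def toEuclid {d : ℕ} (x : Fin d → ℚ) : EuclideanSpace ℝ (Fin d) :=
  WithLp.toLp 2 fun i => (x i : ℝ)

/-- Euclidean distance from a rational vector to a set of rational vectors (the infimum of
distances to elements of the set; meaningful for nonempty sets). -/
noncomputable def distToSet {d : ℕ} (x : Fin d → ℚ) (S : Set (Fin d → ℚ)) : ℝ :=
  Metric.infDist (toEuclid x) (toEuclid '' S)

/-- `f : ℕ → ℕ` is nondecreasing: `f n ≥ n` for all `n`, and `f n < f m` for all `n < m`. -/
def Nondecreasing (f : ℕ → ℕ) : Prop := (∀ n, n ≤ f n) ∧ ∀ n m, n < m → f n < f m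

/-!
A path from `s` to `q(w)` is rearranged into a simple walk and simple cycles of the components, so
that `w` is, up to the effect of the simple walk and the vector of `s`, a sum `x₀ + ⋯ + xₘ` with
`xᵢ` in the closed cone generated by the simple cycles of the `i`-th component. The partial sums
`x₀ + ⋯ + xᵢ` are bounded from below by `-N`, where `N = size(V, s)`, since the configuration in
which the path leaves a component is nonnegative.

Applied to the path that witnesses forward-diagonality, which stays in the first component, this
yields an element of the first closed cone that is positive on every coordinate. By Carathéodory's
theorem for cones and Cramer's rule there is then such an element `y` with `1 ≤ y` on every
coordinate and entries polynomial in `N`. Replacing `x₀` by `x₀ + (N + 2) y` makes all partial sums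
at least `2`, and an arbitrarily small perturbation moves the summands into the open cones. The
resulting element of the sequential cone is at distance `O(N y + N)` from `w`.
-/

section ConicHull

variable {K ι M : Type*} [Field K] [LinearOrder K] [IsStrictOrderedRing K] [AddCommGroup M]
  [Module K M] {f : ι → M} {x : M}

theorem mem_hull_image_finset_iff {t : Finset ι} :
    x ∈ PointedCone.hull K (f '' t) ↔
      ∃ r : ι → K, (∀ a ∈ t, 0 ≤ r a) ∧ ∑ a ∈ t, r a • f a = x := by
  rw [Submodule.mem_span_image_finset_iff_exists_fun']
  constructor
  · rintro ⟨c, rfl⟩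
    exact ⟨fun a => c a, fun a _ => (c a).2, rfl⟩
  · rintro ⟨r, hr, rfl⟩
    refine ⟨fun a => ⟨max (r a) 0, le_max_right _ _⟩, Finset.sum_congr rfl fun a ha => ?_⟩
    rw [Nonneg.mk_smul, max_eq_left (hr a ha)]

theorem exists_mem_hull_image_erase [DecidableEq ι] {t : Finset ι}
    (hli : ¬LinearIndepOn K f (t : Set ι)) (hx : x ∈ PointedCone.hull K (f '' t)) :
    ∃ m ∈ t, x ∈ PointedCone.hull K (f '' (t.erase m : Finset ι)) := by
  obtain ⟨r, hr, rfl⟩ := mem_hull_image_finset_iff.1 hx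
  obtain ⟨g, hg, a₀, ha₀, hga₀⟩ : ∃ g : ι → K, ∑ a ∈ t, g a • f a = 0 ∧ ∃ a ∈ t, 0 < g a := by
    obtain ⟨g, hg, a, ha, hga⟩ := not_linearIndepOn_finset_iff.1 hli
    rcases hga.lt_or_gt with h | h
    · exact ⟨-g, by simp [hg], a, ha, by simpa using h⟩
    · exact ⟨g, hg, a, ha, h⟩
  obtain ⟨m, hm, hmin⟩ := Finset.exists_min_image (t.filter fun a => 0 < g a)
    (fun a => r a / g a) ⟨a₀, by simp [ha₀, hga₀]⟩
  obtain ⟨hmt, hgm⟩ := Finset.mem_filter.1 hm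
  have hnonneg : ∀ a ∈ t, 0 ≤ r a - r m / g m * g a := by
    intro a ha
    rw [sub_nonneg]
    rcases lt_or_ge 0 (g a) with hga | hga
    · exact (le_div_iff₀ hga).1 (hmin a (by simp [ha, hga]))
    · exact (mul_nonpos_of_nonneg_of_nonpos (div_nonneg (hr m hmt) hgm.le) hga).trans (hr a ha)
  refine ⟨m, hmt, mem_hull_image_finset_iff.2
    ⟨_, fun a ha => hnonneg a (Finset.mem_of_mem_erase ha), ?_⟩⟩
  rw [Finset.sum_erase _ (by rw [div_mul_cancel₀ _ hgm.ne', sub_self, zero_smul])]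
  simp only [sub_smul, mul_smul, Finset.sum_sub_distrib, ← Finset.smul_sum, hg, smul_zero, sub_zero]

theorem exists_linearIndepOn_mem_hull_image {s : Set ι} (hx : x ∈ PointedCone.hull K (f '' s)) :
    ∃ t : Finset ι, ↑t ⊆ s ∧ LinearIndepOn K f (t : Set ι) ∧ x ∈ PointedCone.hull K (f '' t) := by
  classical
  obtain ⟨u, hus, hxu⟩ : ∃ u : Finset ι, ↑u ⊆ s ∧ x ∈ PointedCone.hull K (f '' u) := by
    obtain ⟨T, hT, hxT⟩ := Submodule.mem_span_finite_of_mem_span hx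
    obtain ⟨u, hu, rfl⟩ := Finset.subset_set_image_iff.1 hT
    exact ⟨u, hu, by simpa using hxT⟩
  induction u using Finset.strongInduction with
  | H u ih =>
    by_cases hli : LinearIndepOn K f (u : Set ι)
    · exact ⟨u, hus, hli, hxu⟩
    · obtain ⟨m, hm, hxm⟩ := exists_mem_hull_image_erase hli hxu
      exact ih _ (Finset.erase_ssubset hm)
        ((Finset.coe_subset.2 (Finset.erase_subset _ _)).trans hus) hxm

theorem add_pi_single_mem {κ : Type*} [DecidableEq κ] {C : κ → PointedCone K M} {y : κ → M}
    (hy : ∀ l, y l ∈ C l) {j : κ} (hx : x ∈ C j) (l : κ) :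
    (y + Pi.single (M := fun _ => M) j x) l ∈ C l := by
  refine add_mem (hy l) ?_
  rcases eq_or_ne l j with rfl | hl
  · rwa [Pi.single_eq_same]
  · rw [Pi.single_eq_of_ne hl]
    exact zero_mem _

end ConicHull

section SmallSolutions

open scoped Nat Matrix

/-- An integer vector, regarded as a rational vector. -/
abbrev ratVec {n : Type*} (v : n → ℤ) : n → ℚ := fun i => v i

theorem abs_le_of_mulVec_eq {n : Type*} [Fintype n] [DecidableEq n] {A : Matrix n n ℤ}
    {b : n → ℤ} {N : ℕ} (hdet : A.det ≠ 0) (hA : ∀ i j, |A i j| ≤ N) (hb : ∀ i, |b i| ≤ N)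
    {x : n → ℚ} (hx : A.map (Int.cast : ℤ → ℚ) *ᵥ x = ratVec b) (i : n) :
    |x i| ≤ (Fintype.card n)! * N ^ Fintype.card n := by
  have hcramer : (A.det : ℚ) * x i = A.cramer b i := by
    have h : ((A.map (Int.cast : ℤ → ℚ)).adjugate * A.map Int.cast) *ᵥ x =
        A.adjugate.map Int.cast *ᵥ ratVec b := by
      rw [← Matrix.mulVec_mulVec, hx]
      exact congrArg (· *ᵥ ratVec b) ((Int.castRingHom ℚ).map_adjugate A).symm
    rw [Matrix.adjugate_mul, Matrix.smul_mulVec, Matrix.one_mulVec, ← Int.cast_det] at h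
    rw [Matrix.cramer_eq_adjugate_mulVec]
    simpa [Matrix.mulVec, dotProduct] using congrFun h i
  have hnum : |A.cramer b i| ≤ (Fintype.card n)! * (N : ℤ) ^ Fintype.card n := by
    rw [Matrix.cramer_apply, ← nsmul_eq_mul]
    refine Matrix.det_le (abv := AbsoluteValue.abs) fun k l => ?_
    rw [Matrix.updateCol_apply]
    split_ifs
    · exact hb k
    · exact hA k l
  have hone : (1 : ℚ) ≤ |(A.det : ℚ)| := by exact_mod_cast Int.one_le_abs hdet
  calc |x i| ≤ |(A.det : ℚ)| * |x i| := le_mul_of_one_le_left (abs_nonneg _) hone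
    _ = |(A.cramer b i : ℚ)| := by rw [← abs_mul, hcramer]
    _ ≤ _ := by exact_mod_cast hnum

theorem abs_dotProduct_le {n : Type*} [Fintype n] {u v : n → ℤ} {N : ℕ} (hu : ∀ i, |u i| ≤ N)
    (hv : ∀ i, |v i| ≤ N) : |u ⬝ᵥ v| ≤ (Fintype.card n * N ^ 2 : ℕ) := by
  calc |u ⬝ᵥ v| ≤ ∑ i, |u i * v i| := Finset.abs_sum_le_sum_abs _ _
    _ ≤ ∑ _i : n, (N : ℤ) * N := Finset.sum_le_sum fun i _ => by
        rw [abs_mul]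
        exact mul_le_mul (hu i) (hv i) (abs_nonneg _) (Nat.cast_nonneg _)
    _ = _ := by simp [sq]

-- The normal equations `AᵀA x = Aᵀb` turn the possibly overdetermined system into a square one.
theorem abs_le_of_sum_smul_eq {n ι : Type*} [Fintype n] [Fintype ι] {v : ι → n → ℤ} {b : n → ℤ}
    {N : ℕ} (hli : LinearIndependent ℚ fun a => ratVec (v a)) (hv : ∀ a i, |v a i| ≤ N)
    (hb : ∀ i, |b i| ≤ N) {x : ι → ℚ} (hx : ∑ a, x a • ratVec (v a) = ratVec b) (a : ι) :
    |x a| ≤ (Fintype.card ι)! * (Fintype.card n * N ^ 2 : ℕ) ^ Fintype.card ι := by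
  classical
  let A : Matrix n ι ℤ := Matrix.of fun i a => v a i
  let B : Matrix n ι ℚ := A.map Int.cast
  have hgram : (Aᵀ * A).map (Int.cast : ℤ → ℚ) = Bᵀ * B := by
    ext; simp [B, Matrix.mul_apply]
  have hdet : (Aᵀ * A).det ≠ 0 := by
    have hinj : Function.Injective (Bᵀ * B).mulVec := by
      refine LinearMap.ker_eq_bot.1 ((Matrix.ker_mulVecLin_transpose_mul_self B).trans ?_)
      exact LinearMap.ker_eq_bot.2 (Matrix.mulVec_injective_iff.2 hli)
    have hunit := (Matrix.isUnit_iff_isUnit_det _).1 (Matrix.mulVec_injective_iff_isUnit.1 hinj)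
    rw [← hgram, ← Int.cast_det] at hunit
    exact Int.cast_ne_zero.1 hunit.ne_zero
  refine abs_le_of_mulVec_eq hdet (fun i j => abs_dotProduct_le (hv i) (hv j))
    (b := Aᵀ *ᵥ b) (fun j => abs_dotProduct_le (hv j) hb) ?_ a
  have hBx : B *ᵥ x = ratVec b := by
    rw [← hx]
    ext i
    simp [B, A, Matrix.mulVec, dotProduct, mul_comm]
  rw [hgram, ← Matrix.mulVec_mulVec, hBx]
  ext
  simp [B, Matrix.mulVec, dotProduct, ratVec]

end SmallSolutions

section SmallHull

open scoped Nat

theorem ratVec_mem_hull_union_neg_single {n : Type*} [Finite n] [DecidableEq n]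
    {E : Set (n → ℤ)} {b : n → ℤ} {x : n → ℚ} (hx : x ∈ PointedCone.hull ℚ (ratVec '' E))
    (hbx : ratVec b ≤ x) :
    ratVec b ∈ PointedCone.hull ℚ (ratVec '' (E ∪ Set.range fun j => -Pi.single j 1)) := by
  have := Fintype.ofFinite n
  have hslack : ratVec b = x + ∑ j, (x - ratVec b) j • ratVec (-Pi.single j 1) := by
    ext i
    simp [ratVec, Pi.single_apply]
  rw [hslack]
  refine add_mem (Submodule.span_mono (Set.image_mono Set.subset_union_left) hx) ?_
  refine sum_mem fun j _ => PointedCone.smul_mem _ (sub_nonneg.2 (hbx j)) ?_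
  exact Submodule.subset_span ⟨_, Or.inr ⟨j, rfl⟩, rfl⟩

variable {n : Type*} [Fintype n]

/-- A bound for the entries of a small element of the conic hull of integer vectors of dimension
`d` with entries at most `N`, see `exists_mem_hull_le_and_abs_le`. It is written over an arbitrary
semiring so that it can also be read as a polynomial in `N`. -/
def hullBound {R : Type*} [Semiring R] (d : ℕ) (N : R) : R :=
  d * (d ! * (d * N ^ 2) ^ d * N)

theorem card_le_of_linearIndepOn {t : Finset (n → ℤ)}
    (hli : LinearIndepOn ℚ ratVec (t : Set (n → ℤ))) : t.card ≤ Fintype.card n := by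
  simpa using LinearIndependent.fintype_card_le_finrank (R := ℚ) hli

theorem abs_coeff_le_of_linearIndepOn [Nonempty n] {t : Finset (n → ℤ)} {N : ℕ} (hN : 1 ≤ N)
    (hli : LinearIndepOn ℚ ratVec (t : Set (n → ℤ))) (ht : ∀ e ∈ t, ∀ i, |e i| ≤ N) {b : n → ℤ}
    (hb : ∀ i, |b i| ≤ N) {r : (n → ℤ) → ℚ} (hr : ∑ e ∈ t, r e • ratVec e = ratVec b)
    {e : n → ℤ} (he : e ∈ t) :
    |r e| ≤ ((Fintype.card n)! * (Fintype.card n * N ^ 2) ^ Fintype.card n : ℕ) := by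
  have hcard : Fintype.card t ≤ Fintype.card n := by
    simpa using card_le_of_linearIndepOn hli
  have hpos : 0 < Fintype.card n * N ^ 2 := by have := Fintype.card_pos (α := n); positivity
  calc |r e| ≤ ((Fintype.card t)! * (Fintype.card n * N ^ 2) ^ Fintype.card t : ℕ) := by
        exact_mod_cast abs_le_of_sum_smul_eq (v := fun e : t => (e : n → ℤ)) hli
          (fun e => ht e e.2) hb (x := fun e => r e)
          (by rwa [t.sum_coe_sort fun e => r e • ratVec e]) ⟨e, he⟩
    _ ≤ _ := Nat.cast_le.2 <|
      Nat.mul_le_mul (Nat.factorial_le hcard) (Nat.pow_le_pow_right hpos hcard)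

theorem abs_sum_smul_ratVec_le {t u : Finset (n → ℤ)} {N : ℕ} (hN : 1 ≤ N)
    (hli : LinearIndepOn ℚ ratVec (t : Set (n → ℤ))) (ht : ∀ e ∈ t, ∀ i, |e i| ≤ N) {b : n → ℤ}
    (hb : ∀ i, |b i| ≤ N) {r : (n → ℤ) → ℚ} (hr : ∑ e ∈ t, r e • ratVec e = ratVec b)
    (hu : u ⊆ t) (i : n) :
    |(∑ e ∈ u, r e • ratVec e) i| ≤ hullBound (Fintype.card n) (N : ℚ) := by
  have : Nonempty n := ⟨i⟩
  have hterm : ∀ e ∈ u, |r e * e i| ≤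
      ((Fintype.card n)! * (Fintype.card n * N ^ 2) ^ Fintype.card n : ℕ) * N := by
    intro e he
    rw [abs_mul]
    exact mul_le_mul (abs_coeff_le_of_linearIndepOn hN hli ht hb hr (hu he))
      (by exact_mod_cast ht e (hu he) i) (abs_nonneg _) (Nat.cast_nonneg _)
  have hcard : u.card ≤ Fintype.card n :=
    (Finset.card_le_card hu).trans (card_le_of_linearIndepOn hli)
  rw [Finset.sum_apply]
  refine (Finset.abs_sum_le_sum_abs _ _).trans ((Finset.sum_le_card_nsmul _ _ _ hterm).trans ?_)
  rw [nsmul_eq_mul, hullBound]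
  push_cast
  gcongr

-- Slack vectors turn the inequality `b ≤ x` into an equation, to which conic Carathéodory applies.
theorem exists_mem_hull_le_and_abs_le {E : Set (n → ℤ)} {N : ℕ} (hN : 1 ≤ N)
    (hE : ∀ e ∈ E, ∀ i, |e i| ≤ N) {b : n → ℤ} (hb : ∀ i, |b i| ≤ N) {x : n → ℚ}
    (hx : x ∈ PointedCone.hull ℚ (ratVec '' E)) (hbx : ratVec b ≤ x) :
    ∃ y ∈ PointedCone.hull ℚ (ratVec '' E),
      ratVec b ≤ y ∧ ∀ i, |y i| ≤ hullBound (Fintype.card n) (N : ℚ) := by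
  classical
  obtain ⟨t, ht, hli, hbt⟩ :=
    exists_linearIndepOn_mem_hull_image (ratVec_mem_hull_union_neg_single hx hbx)
  obtain ⟨r, hr, hrb⟩ := mem_hull_image_finset_iff.1 hbt
  have htN : ∀ e ∈ t, ∀ i, |e i| ≤ N := by
    intro e he i
    rcases ht he with he | ⟨j, rfl⟩
    · exact hE e he i
    · simp only [Pi.neg_apply, abs_neg, Pi.single_apply]
      split_ifs <;> simp [hN]
  refine ⟨∑ e ∈ t with e ∈ E, r e • ratVec e, ?_, ?_, fun i => ?_⟩
  · refine sum_mem fun e he => ?_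
    obtain ⟨het, heE⟩ := Finset.mem_filter.1 he
    exact PointedCone.smul_mem _ (hr e het) (Submodule.subset_span ⟨e, heE, rfl⟩)
  · rw [← hrb, ← Finset.sum_filter_add_sum_filter_not t (· ∈ E)]
    refine add_le_of_nonpos_right (Finset.sum_nonpos fun e he => ?_)
    obtain ⟨het, heE⟩ := Finset.mem_filter.1 he
    obtain ⟨j, rfl⟩ := (ht het).resolve_left heE
    refine smul_nonpos_of_nonneg_of_nonpos (hr _ het) fun i => ?_
    simp only [ratVec, Pi.neg_apply, Pi.single_apply]
    split_ifs <;> simp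
  · exact abs_sum_smul_ratVec_le hN hli htN hb hrb (Finset.filter_subset _ _) i

theorem exists_small_pos_mem_hull {E : Set (n → ℤ)} {N : ℕ} (hN : 1 ≤ N)
    (hE : ∀ e ∈ E, ∀ i, |e i| ≤ N) {x : n → ℚ} (hx : x ∈ PointedCone.hull ℚ (ratVec '' E))
    (hpos : ∀ i, 0 < x i) :
    ∃ y ∈ PointedCone.hull ℚ (ratVec '' E),
      ∀ i, 1 ≤ y i ∧ y i ≤ hullBound (Fintype.card n) (N : ℚ) := by
  have hc : ∀ i, 0 ≤ (x i)⁻¹ := fun i => (inv_pos.2 (hpos i)).le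
  have hone : ratVec (1 : n → ℤ) ≤ (∑ i, (x i)⁻¹) • x := fun i => by
    have := Finset.single_le_sum (fun j _ => hc j) (Finset.mem_univ i)
    simpa [ratVec] using (inv_le_iff_one_le_mul₀ (hpos i)).1 this
  obtain ⟨y, hy, h1y, hyN⟩ := exists_mem_hull_le_and_abs_le hN hE (fun _ => by simpa using hN)
    (PointedCone.smul_mem _ (Finset.sum_nonneg fun i _ => hc i) hx) hone
  exact ⟨y, hy, fun i => ⟨by simpa [ratVec] using h1y i, (le_abs_self _).trans (hyN i)⟩⟩

end SmallHull

theorem natAbs_le_vecNorm {d : ℕ} (v : Fin d → ℤ) (i : Fin d) : (v i).natAbs ≤ vecNorm v :=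
  Finset.single_le_sum (f := fun i => (v i).natAbs) (fun _ _ => Nat.zero_le _) (Finset.mem_univ i)

theorem vecNorm_add_le {d : ℕ} (u v : Fin d → ℤ) : vecNorm (u + v) ≤ vecNorm u + vecNorm v := by
  simp only [vecNorm, ← Finset.sum_add_distrib]
  exact Finset.sum_le_sum fun i _ => Int.natAbs_add_le _ _

theorem Config.vec_le_norm {d : ℕ} {σ : Type*} (c : Config d σ) (i : Fin d) : c.vec i ≤ c.norm :=
  natAbs_le_vecNorm (fun i => (c.vec i : ℤ)) i

namespace VASS

variable {d : ℕ} {σ : Type*} {V : VASS d σ} {p q : σ} {ρ ρ₁ ρ₂ : List (Transition d σ)}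

@[simp]
theorem effect_nil : effect ([] : List (Transition d σ)) = 0 := rfl

@[simp]
theorem effect_cons (t : Transition d σ) (ρ : List (Transition d σ)) :
    effect (t :: ρ) = t.eff + effect ρ := by
  simp [effect]

@[simp]
theorem effect_append (ρ₁ ρ₂ : List (Transition d σ)) :
    effect (ρ₁ ++ ρ₂) = effect ρ₁ + effect ρ₂ := by
  simp [effect]

theorem vecNorm_effect_le (ρ : List (Transition d σ)) :
    vecNorm (effect ρ) ≤ (ρ.map fun t => vecNorm t.eff).sum := by
  induction ρ with
  | nil => simp [vecNorm]
  | cons t ρ ih =>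
    simpa using (vecNorm_add_le _ _).trans (Nat.add_le_add_left ih _)

theorem vecNorm_effect_le_size (hmem : ∀ t ∈ ρ, t ∈ V.trans) (hnodup : ρ.Nodup) :
    vecNorm (effect ρ) ≤ V.size := by
  classical
  calc vecNorm (effect ρ) ≤ (ρ.map fun t => vecNorm t.eff).sum := vecNorm_effect_le ρ
    _ = ∑ t ∈ ρ.toFinset, vecNorm t.eff := (List.sum_toFinset _ hnodup).symm
    _ ≤ ∑ t ∈ V.trans, vecNorm t.eff :=
      Finset.sum_le_sum_of_subset fun t ht => hmem t (List.mem_toFinset.1 ht)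
    _ ≤ V.size := Nat.le_add_right _ _

/-- `V.Walk p ρ q`: the transitions `ρ` lead from `p` to `q` in the state graph of `V`. Unlike in
`Path`, no vector has to stay nonnegative. -/
def Walk (V : VASS d σ) : σ → List (Transition d σ) → σ → Prop
  | p, [], q => p = q
  | p, t :: ρ, q => t ∈ V.trans ∧ t.src = p ∧ Walk V t.tgt ρ q

theorem Walk.mem_trans (h : V.Walk p ρ q) : ∀ t ∈ ρ, t ∈ V.trans := by
  induction ρ generalizing p with
  | nil => simp
  | cons t ρ ih => exact List.forall_mem_cons.2 ⟨h.1, ih h.2.2⟩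

theorem walk_append : V.Walk p (ρ₁ ++ ρ₂) q ↔ ∃ r, V.Walk p ρ₁ r ∧ V.Walk r ρ₂ q := by
  induction ρ₁ generalizing p with
  | nil => simp [Walk]
  | cons t ρ ih => simp [Walk, ih, and_assoc]

theorem Walk.exists_path_of_sum_le (h : V.Walk p ρ q) (hq : q ∈ V.states) {c : Config d σ}
    (hc : c.state = p) (hsum : ∀ i, (ρ.map fun t => vecNorm t.eff).sum ≤ c.vec i) :
    ∃ c' : Config d σ, c'.state = q ∧ V.Path c ρ c' := by
  induction ρ generalizing p c with
  | nil =>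
    obtain rfl : p = q := h
    exact ⟨c, hc, .nil c (hc ▸ hq)⟩
  | cons t ρ ih =>
    obtain ⟨ht, rfl, hρ⟩ := h
    simp only [List.map_cons, List.sum_cons] at hsum
    have hnorm := natAbs_le_vecNorm t.eff
    obtain ⟨c', hc', hpath⟩ :=
      ih hρ (c := ⟨t.tgt, fun i => ((c.vec i : ℤ) + t.eff i).toNat⟩) rfl fun i => by
        grind
    refine ⟨c', hc', .cons ⟨ht, hc.symm, rfl, fun i => ?_⟩ hpath⟩
    grind

theorem Walk.isSimpleCycle (h : V.Walk p ρ p) (hp : p ∈ V.states) (hne : ρ ≠ [])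
    (hnodup : (ρ.map Transition.src).Nodup) : V.IsSimpleCycle ρ := by
  obtain ⟨c', hc', hpath⟩ := h.exists_path_of_sum_le hp
    (c := ⟨p, fun _ => (ρ.map fun t => vecNorm t.eff).sum⟩) rfl fun _ => le_rfl
  exact ⟨hne, ⟨_, c', hc'.symm, hpath⟩, hnodup⟩

theorem Walk.exists_eq_append (h : V.Walk p ρ q) :
    ∃ ρ₁ ρ₂, ρ = ρ₁ ++ ρ₂ ∧ V.Walk p ρ₁ q ∧ V.Walk q ρ₂ q ∧ q ∉ ρ₁.map Transition.src := by
  induction ρ generalizing p with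
  | nil => exact ⟨[], [], rfl, h, rfl, by simp⟩
  | cons t ρ ih =>
    obtain ⟨ht, rfl, hρ⟩ := h
    obtain ⟨ρ₁, ρ₂, rfl, h₁, h₂, hq⟩ := ih hρ
    by_cases htq : t.src = q
    · exact ⟨[], t :: (ρ₁ ++ ρ₂), rfl, htq, ⟨ht, htq, hρ⟩, by simp⟩
    · exact ⟨t :: ρ₁, ρ₂, rfl, ⟨ht, rfl, h₁⟩, h₂, by simpa [Ne.symm htq] using hq⟩

/-- `V.IsSimpleWalk p ρ q`: the walk `ρ` from `p` to `q` visits no state twice; in particular it is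
empty if `p = q`. -/
structure IsSimpleWalk (V : VASS d σ) (p : σ) (ρ : List (Transition d σ)) (q : σ) : Prop where
  walk : V.Walk p ρ q
  nodup : (ρ.map Transition.src).Nodup
  notMem : q ∉ ρ.map Transition.src

theorem isSimpleWalk_nil (V : VASS d σ) (p : σ) : V.IsSimpleWalk p [] p :=
  ⟨rfl, by simp, by simp⟩

theorem IsSimpleWalk.eq_nil (h : V.IsSimpleWalk p ρ p) : ρ = [] := by
  rcases ρ with - | ⟨t, ρ⟩
  · rfl
  · exact absurd (by simp [h.walk.2.1]) h.notMem

theorem IsSimpleWalk.exists_append_singleton_eq (h : V.IsSimpleWalk p ρ q) {t : Transition d σ}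
    (ht : t ∈ V.trans) (hsrc : t.src = q) :
    ∃ ρ' γ, ρ ++ [t] = ρ' ++ γ ∧ V.IsSimpleWalk p ρ' t.tgt ∧ V.Walk t.tgt γ t.tgt ∧
      (γ.map Transition.src).Nodup := by
  have hwalk : V.Walk p (ρ ++ [t]) t.tgt := walk_append.2 ⟨q, h.walk, ht, hsrc, rfl⟩
  have hnodup : ((ρ ++ [t]).map Transition.src).Nodup := by
    rw [List.map_append, List.map_singleton, ← List.concat_eq_append]
    exact h.nodup.concat (hsrc ▸ h.notMem)
  obtain ⟨ρ', γ, heq, hρ', hγ, hnot⟩ := hwalk.exists_eq_append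
  rw [heq, List.map_append] at hnodup
  exact ⟨ρ', γ, heq, ⟨hρ', hnodup.of_append_left, hnot⟩, hγ, hnodup.of_append_right⟩

theorem IsSimpleWalk.abs_vec_add_effect_le {s : Config d σ} (h : V.IsSimpleWalk p ρ q) (i : Fin d) :
    |(s.vec i : ℤ) + effect ρ i| ≤ V.sizeWith s := by
  have hs := s.vec_le_norm i
  have hρ := (natAbs_le_vecNorm (effect ρ) i).trans
    (vecNorm_effect_le_size h.walk.mem_trans h.nodup.of_map)
  simp only [sizeWith]
  grind

theorem abs_le_size_of_mem_simpleCycleEffects {e : Fin d → ℤ} (he : e ∈ V.simpleCycleEffects)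
    (i : Fin d) : |e i| ≤ V.size := by
  obtain ⟨π, ⟨-, ⟨_, _, -, hpath⟩, hnodup⟩, rfl⟩ := he
  have := (natAbs_le_vecNorm (effect π) i).trans
    (vecNorm_effect_le_size hpath.mem_trans hnodup.of_map)
  grind

/-- The conic hull of the effects of the simple cycles of `V`: the analogue of `VASS.cone` with
nonnegative instead of positive coefficients. -/
def cycleCone (V : VASS d σ) : PointedCone ℚ (Fin d → ℚ) :=
  PointedCone.hull ℚ (ratVec '' V.simpleCycleEffects)

theorem Walk.ratVec_effect_mem_cycleCone (h : V.Walk p ρ p) (hp : p ∈ V.states)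
    (hnodup : (ρ.map Transition.src).Nodup) : ratVec (effect ρ) ∈ V.cycleCone := by
  rcases eq_or_ne ρ [] with rfl | hne
  · have : ratVec (0 : Fin d → ℤ) = 0 := by ext; simp [ratVec]
    rw [effect_nil, this]
    exact zero_mem _
  · exact Submodule.subset_span ⟨_, ⟨ρ, h.isSimpleCycle hp hne hnodup, rfl⟩, rfl⟩

theorem cone_nonempty (V : VASS d σ) : V.cone.Nonempty :=
  ⟨_, 1, fun _ _ => one_pos, rfl⟩

theorem add_smul_mem_cone {x y : Fin d → ℚ} (hx : x ∈ V.cycleCone) (hy : y ∈ V.cone) {ε : ℚ}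
    (hε : 0 < ε) : x + ε • y ∈ V.cone := by
  rw [cycleCone, ← V.simpleCycleEffects_finite.coe_toFinset, mem_hull_image_finset_iff] at hx
  obtain ⟨r, hr, rfl⟩ := hx
  obtain ⟨r', hr', rfl⟩ := hy
  refine ⟨fun e => r e + ε * r' e, fun e he => ?_, ?_⟩
  · exact add_pos_of_nonneg_of_pos (hr e (by simpa using he)) (mul_pos hε (hr' e he))
  · simp only [add_smul, mul_smul, Finset.sum_add_distrib, Finset.smul_sum]

theorem exists_mem_cone_abs_sub_le {x : Fin d → ℚ} (hx : x ∈ V.cycleCone) {δ : ℚ} (hδ : 0 < δ) :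
    ∃ v ∈ V.cone, ∀ i, |v i - x i| ≤ δ := by
  obtain ⟨y, hy⟩ := V.cone_nonempty
  have hpos : 0 < 1 + ∑ i, |y i| := by positivity
  refine ⟨_, add_smul_mem_cone hx hy (div_pos hδ hpos), fun i => ?_⟩
  have hyi : |y i| ≤ 1 + ∑ i, |y i| :=
    (Finset.single_le_sum (fun i _ => abs_nonneg (y i)) (Finset.mem_univ i)).trans
      (le_add_of_nonneg_left zero_le_one)
  rw [Pi.add_apply, add_sub_cancel_left, Pi.smul_apply, smul_eq_mul, abs_mul,
    abs_of_pos (div_pos hδ hpos), div_mul_eq_mul_div, div_le_iff₀ hpos]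
  gcongr

end VASS

namespace VASS.Sequential

variable {d : ℕ} {σ : Type*} {V : VASS d σ} (S : V.Sequential) {s c c' : Config d σ}
  {p q : σ} {ρ : List (Transition d σ)} {i j : Fin (S.m + 1)} {x : Fin (S.m + 1) → Fin d → ℚ}

theorem index_unique (hi : q ∈ (S.comp i).states) (hj : q ∈ (S.comp j).states) : i = j := by
  by_contra h
  exact Finset.disjoint_left.1 (S.disjoint i j h) hi hj

theorem comp_trans_subset (i : Fin (S.m + 1)) : (S.comp i).trans ⊆ V.trans := fun t ht =>
  (S.trans_eq t).2 (Or.inl ⟨i, ht⟩)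

theorem comp_size_le (i : Fin (S.m + 1)) : (S.comp i).size ≤ V.size :=
  Nat.add_le_add (Finset.sum_le_sum_of_subset (S.comp_trans_subset i))
    (Finset.card_le_card (S.comp_trans_subset i))

theorem index_le_of_mem_trans {t : Transition d σ} (ht : t ∈ V.trans)
    (hi : t.src ∈ (S.comp i).states) (hj : t.tgt ∈ (S.comp j).states) : i ≤ j := by
  rcases (S.trans_eq t).1 ht with ⟨a, ha⟩ | ⟨a, rfl⟩
  · exact (S.index_unique hi ((S.comp a).src_mem t ha)).trans
      (S.index_unique hj ((S.comp a).tgt_mem t ha)).symm |>.le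
  · rw [S.index_unique hi (S.bridge_src a), S.index_unique hj (S.bridge_tgt a)]
    exact Fin.castSucc_lt_succ.le

theorem mem_comp_trans {t : Transition d σ} (ht : t ∈ V.trans)
    (hsrc : t.src ∈ (S.comp i).states) (htgt : t.tgt ∈ (S.comp i).states) :
    t ∈ (S.comp i).trans := by
  rcases (S.trans_eq t).1 ht with ⟨a, ha⟩ | ⟨a, rfl⟩
  · rwa [S.index_unique hsrc ((S.comp a).src_mem t ha)]
  · have h := (S.index_unique (S.bridge_src a) hsrc).trans (S.index_unique htgt (S.bridge_tgt a))
    exact absurd h Fin.castSucc_lt_succ.ne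

theorem index_le_of_walk (h : V.Walk p ρ q) (hi : p ∈ (S.comp i).states)
    (hj : q ∈ (S.comp j).states) : i ≤ j := by
  induction ρ generalizing p i with
  | nil =>
    obtain rfl : p = q := h
    exact (S.index_unique hi hj).le
  | cons t ρ ih =>
    obtain ⟨ht, rfl, hρ⟩ := h
    obtain ⟨a, ha⟩ := (S.states_eq _).1 (V.tgt_mem t ht)
    exact (S.index_le_of_mem_trans ht hi ha).trans (ih hρ ha)

theorem walk_comp (h : V.Walk p ρ q) (hp : p ∈ (S.comp i).states)
    (hq : q ∈ (S.comp i).states) : (S.comp i).Walk p ρ q := by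
  induction ρ generalizing p with
  | nil => exact h
  | cons t ρ ih =>
    obtain ⟨ht, rfl, hρ⟩ := h
    obtain ⟨a, ha⟩ := (S.states_eq _).1 (V.tgt_mem t ht)
    obtain rfl : i = a := (S.index_le_of_mem_trans ht hp ha).antisymm (S.index_le_of_walk hρ ha hq)
    exact ⟨S.mem_comp_trans ht hp ha, rfl, ih hρ ha⟩

/-- A normal form of paths from `s` to `c`, following the decomposition into simple cycles and a
simple walk: `x l` collects the effects of the cycles removed in the `l`-th component, and `ρ` is
the walk that remains. The lower bound on the partial sums `x 0 + ⋯ + x l` reflects that the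
configurations at which the path leaves a component are nonnegative. -/
structure IsDecomposition (s c : Config d σ) (x : Fin (S.m + 1) → Fin d → ℚ)
    (ρ : List (Transition d σ)) : Prop where
  mem_cycleCone : ∀ l, x l ∈ (S.comp l).cycleCone
  eq_zero : ∀ i l, c.state ∈ (S.comp i).states → i < l → x l = 0
  neg_sizeWith_le : ∀ i a, -(V.sizeWith s : ℚ) ≤ (∑ l ∈ Finset.Iic i, x l) a
  isSimpleWalk : V.IsSimpleWalk s.state ρ c.state
  vec_eq : ∀ a, (c.vec a : ℚ) = s.vec a + (∑ l, x l) a + effect ρ a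

variable {S}

theorem isDecomposition_refl (s : Config d σ) : S.IsDecomposition s s 0 [] where
  mem_cycleCone _ := zero_mem _
  eq_zero _ _ _ _ := rfl
  neg_sizeWith_le := by simp
  isSimpleWalk := V.isSimpleWalk_nil _
  vec_eq := by simp

theorem abs_vec_sub_le_sizeWith {y : Fin d → ℚ} (hρ : V.IsSimpleWalk p ρ q)
    (h : ∀ a, (c.vec a : ℚ) = s.vec a + y a + effect ρ a) (a : Fin d) :
    |c.vec a - y a| ≤ V.sizeWith s := by
  have hs : |(s.vec a : ℚ) + effect ρ a| ≤ V.sizeWith s := by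
    exact_mod_cast hρ.abs_vec_add_effect_le (s := s) a
  rwa [h a, add_right_comm, add_sub_cancel_right]

theorem exists_isSimpleWalk_add_mem_cycleCone (hρ : V.IsSimpleWalk p ρ q) {t : Transition d σ}
    (ht : t ∈ V.trans) (hsrc : t.src = q) (hj : t.tgt ∈ (S.comp j).states) :
    ∃ ρ', V.IsSimpleWalk p ρ' t.tgt ∧ ∃ y ∈ (S.comp j).cycleCone,
      ∀ a, (effect ρ a : ℚ) + t.eff a = effect ρ' a + y a := by
  obtain ⟨ρ', γ, hsplit, hρ', hγ, hnodup⟩ := hρ.exists_append_singleton_eq ht hsrc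
  refine ⟨ρ', hρ', _, (S.walk_comp hγ hj hj).ratVec_effect_mem_cycleCone hj hnodup, fun a => ?_⟩
  have heffect := congrFun (congrArg effect hsplit) a
  simp only [effect_append, effect_cons, effect_nil, add_zero, Pi.add_apply] at heffect
  exact_mod_cast heffect

theorem IsDecomposition.step (h : S.IsDecomposition s c x ρ) {t : Transition d σ}
    (hstep : V.Step c t c') : ∃ x' ρ', S.IsDecomposition s c' x' ρ' := by
  obtain ⟨ht, hsrc, htgt, hvec⟩ := hstep
  obtain ⟨i₀, hi₀⟩ := (S.states_eq _).1 (V.src_mem t ht)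
  obtain ⟨j, hj⟩ := (S.states_eq _).1 (V.tgt_mem t ht)
  have hij := S.index_le_of_mem_trans ht hi₀ hj
  obtain ⟨ρ', hρ', y, hy, hρy⟩ := exists_isSimpleWalk_add_mem_cycleCone h.isSimpleWalk ht hsrc hj
  rw [hsrc] at hi₀
  rw [htgt] at hj hρ'
  let x' := x + Pi.single j y
  have hx' : ∀ l, j < l → x' l = 0 := fun l hl => by
    simp [x', h.eq_zero i₀ l hi₀ (hij.trans_lt hl), hl.ne']
  have hvec' : ∀ a, (c'.vec a : ℚ) = s.vec a + (∑ l, x' l) a + effect ρ' a := by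
    intro a
    have hstep : (c'.vec a : ℚ) = c.vec a + t.eff a := by exact_mod_cast hvec a
    have hsum : ∑ l, x' l = ∑ l, x l + y := by simp [x', Finset.sum_add_distrib]
    rw [hstep, h.vec_eq, hsum, Pi.add_apply]
    linarith [hρy a]
  refine ⟨x', ρ', add_pi_single_mem h.mem_cycleCone hy,
    fun i l hi hl => hx' l (S.index_unique hi hj ▸ hl), fun i a => ?_, hρ', hvec'⟩
  rcases lt_or_ge i j with hi | hi
  · have : ∑ l ∈ Finset.Iic i, x' l = ∑ l ∈ Finset.Iic i, x l :=
      Finset.sum_congr rfl fun l hl => by simp [x', ((Finset.mem_Iic.1 hl).trans_lt hi).ne]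
    rw [this]
    exact h.neg_sizeWith_le i a
  · have : ∑ l ∈ Finset.Iic i, x' l = ∑ l, x' l :=
      Finset.sum_subset (Finset.subset_univ _) fun l _ hl =>
        hx' l (hi.trans_lt (by simpa using hl))
    have habs := abs_le.1 (abs_vec_sub_le_sizeWith hρ' hvec' a)
    rw [this]
    linarith [Nat.cast_nonneg (α := ℚ) (c'.vec a)]

theorem IsDecomposition.path {π : List (Transition d σ)} (h : S.IsDecomposition s c x ρ)
    (hπ : V.Path c π c') : ∃ x' ρ', S.IsDecomposition s c' x' ρ' := by
  induction hπ generalizing x ρ with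
  | nil => exact ⟨x, ρ, h⟩
  | cons hstep _ ih =>
    obtain ⟨_, _, h'⟩ := h.step hstep
    exact ih h'

theorem exists_isDecomposition (h : V.Reachable s c) : ∃ x ρ, S.IsDecomposition s c x ρ :=
  (isDecomposition_refl s).path h.choose_spec

theorem exists_pos_mem_cycleCone (hs : s.state ∈ (S.comp 0).states) (h : V.ForwardDiagonal s) :
    ∃ y ∈ (S.comp 0).cycleCone, ∀ a, 0 < y a := by
  obtain ⟨Δ, hΔ, hreach⟩ := h
  obtain ⟨x, ρ, hx⟩ := S.exists_isDecomposition hreach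
  obtain rfl : ρ = [] := hx.isSimpleWalk.eq_nil
  have hsum : ∑ l, x l = x 0 :=
    Finset.sum_eq_single 0 (fun l _ hl => hx.eq_zero 0 l hs (Fin.pos_iff_ne_zero.2 hl)) (by simp)
  have hvec := hx.vec_eq
  simp only [hsum, Pi.add_apply, Nat.cast_add, effect_nil, Pi.zero_apply, Int.cast_zero, add_zero,
    add_right_inj] at hvec
  exact ⟨x 0, hx.mem_cycleCone 0, fun a => hvec a ▸ Nat.cast_pos.2 (hΔ a)⟩

theorem exists_small_pos_mem_cycleCone (hs : s.state ∈ (S.comp 0).states)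
    (h : V.ForwardDiagonal s) :
    ∃ y ∈ (S.comp 0).cycleCone,
      ∀ a, 1 ≤ y a ∧ y a ≤ hullBound d (V.sizeWith s + 1 : ℚ) := by
  obtain ⟨x, hx, hpos⟩ := S.exists_pos_mem_cycleCone hs h
  have hle : (S.comp 0).size ≤ V.sizeWith s + 1 :=
    (S.comp_size_le 0).trans ((Nat.le_add_right _ _).trans (Nat.le_succ _))
  simpa [cycleCone] using exists_small_pos_mem_hull (Nat.le_add_left 1 (V.sizeWith s))
    (fun e he a => (abs_le_size_of_mem_simpleCycleEffects he a).trans (by exact_mod_cast hle))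
    hx hpos

-- Adding `(N + 2) • y` to `x 0` makes all partial sums at least `2`, which leaves room for a total
-- error of `1` when the vectors are moved from the closed cones into the open ones.
theorem exists_mem_seqCone_abs_sub_le (hx : ∀ i, x i ∈ (S.comp i).cycleCone) {N : ℚ} (hN : 0 ≤ N)
    (hsum : ∀ i a, -N ≤ (∑ l ∈ Finset.Iic i, x l) a) {y : Fin d → ℚ}
    (hy : y ∈ (S.comp 0).cycleCone) (hy1 : ∀ a, 1 ≤ y a) :
    ∃ z ∈ S.seqCone, ∀ a, |z a - (∑ i, x i) a| ≤ (N + 2) * y a + 1 := by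
  let u := x + Pi.single 0 ((N + 2) • y)
  have hu : ∀ i, u i ∈ (S.comp i).cycleCone :=
    add_pi_single_mem hx (PointedCone.smul_mem _ (by positivity) hy)
  have hδ : (0 : ℚ) < 1 / (S.m + 1) := by positivity
  choose v hv hvu using fun i => exists_mem_cone_abs_sub_le (hu i) hδ
  have hvx : ∀ t : Finset (Fin (S.m + 1)), 0 ∈ t → ∀ a,
      |(∑ l ∈ t, v l) a - ((∑ l ∈ t, x l) a + (N + 2) * y a)| ≤ 1 := by
    intro t h0 a
    have hut : (∑ l ∈ t, x l) a + (N + 2) * y a = ∑ l ∈ t, u l a := by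
      simp [u, Finset.sum_add_distrib, ← Finset.sum_apply, h0]
    rw [hut, Finset.sum_apply, ← Finset.sum_sub_distrib]
    refine (Finset.abs_sum_le_sum_abs _ _).trans
      ((Finset.sum_le_card_nsmul _ _ _ fun l _ => hvu l a).trans ?_)
    have hcard : (t.card : ℚ) ≤ S.m + 1 := by exact_mod_cast card_finset_fin_le t
    rw [nsmul_eq_mul, mul_one_div]
    exact div_le_one_of_le₀ hcard (by positivity)
  have hNy : ∀ a, N + 2 ≤ (N + 2) * y a := fun a => le_mul_of_one_le_right (by positivity) (hy1 a)
  refine ⟨∑ i, v i, ⟨v, hv, fun i a => ?_, rfl⟩, fun a => ?_⟩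
  · have := abs_le.1 (hvx _ (Finset.mem_Iic.2 (Fin.zero_le i)) a)
    linarith [hsum i a, hNy a]
  · have := abs_le.1 (hvx _ (Finset.mem_univ 0) a)
    exact abs_le.2 ⟨by linarith [hNy a], by linarith⟩

theorem exists_mem_seqCone_abs_sub_vec_le (hs : s.state ∈ (S.comp 0).states)
    (hdiag : V.ForwardDiagonal s) (hc : V.Reachable s c) :
    ∃ z ∈ S.seqCone, ∀ a, |z a - c.vec a| ≤
      (V.sizeWith s + 2) * hullBound d (V.sizeWith s + 1 : ℚ) + V.sizeWith s + 1 := by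
  obtain ⟨y, hy, hyN⟩ := S.exists_small_pos_mem_cycleCone hs hdiag
  obtain ⟨x, ρ, hx⟩ := S.exists_isDecomposition hc
  obtain ⟨z, hz, hzx⟩ := exists_mem_seqCone_abs_sub_le hx.mem_cycleCone (Nat.cast_nonneg _)
    hx.neg_sizeWith_le hy fun a => (hyN a).1
  refine ⟨z, hz, fun a => ?_⟩
  calc |z a - c.vec a| ≤ |z a - (∑ i, x i) a| + |(∑ i, x i) a - c.vec a| := abs_sub_le _ _ _
    _ ≤ (V.sizeWith s + 2) * y a + 1 + V.sizeWith s := by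
      rw [abs_sub_comm (_ : ℚ) (c.vec a : ℚ)]
      exact add_le_add (hzx a) (abs_vec_sub_le_sizeWith hx.isSimpleWalk hx.vec_eq a)
    _ ≤ (V.sizeWith s + 2) * hullBound d (V.sizeWith s + 1 : ℚ) + 1 + V.sizeWith s := by
      gcongr
      exact (hyN a).2
    _ = _ := by ring

end VASS.Sequential

theorem distToSet_le {d : ℕ} {x z : Fin d → ℚ} {S : Set (Fin d → ℚ)} (hz : z ∈ S) {D : ℚ}
    (h : ∀ a, |z a - x a| ≤ D) : distToSet x S ≤ d * D := by
  calc distToSet x S ≤ dist (toEuclid x) (toEuclid z) :=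
        Metric.infDist_le_dist_of_mem (Set.mem_image_of_mem _ hz)
    _ ≤ ∑ a, dist (toEuclid x a) (toEuclid z a) := by
        rw [EuclideanSpace.dist_eq]
        exact Real.sqrt_le_iff.2 ⟨Finset.sum_nonneg fun _ _ => dist_nonneg,
          Finset.sum_sq_le_sq_sum_of_nonneg fun _ _ => dist_nonneg⟩
    _ ≤ ∑ _a : Fin d, (D : ℝ) := by
        refine Finset.sum_le_sum fun a _ => ?_
        rw [dist_comm, Real.dist_eq]
        simp only [toEuclid]
        exact_mod_cast h a
    _ = d * D := by simp

theorem nondecreasing_succ_mul_add_hullBound (d : ℕ) :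
    Nondecreasing fun n => (d + 1) * ((n + 2) * hullBound d (n + 1) + n + 1) := by
  refine ⟨fun n => ?_, fun n m h => ?_⟩
  · calc n ≤ 1 * ((n + 2) * hullBound d (n + 1) + n + 1) := by omega
      _ ≤ _ := Nat.mul_le_mul_right _ (Nat.le_add_left 1 d)
  · have hmono : hullBound d (n + 1) ≤ hullBound d (m + 1) := by
      rw [hullBound, hullBound]
      gcongr
    have := Nat.mul_le_mul (Nat.add_le_add_right h.le 2) hmono
    exact Nat.mul_lt_mul_of_pos_left (by omega) d.succ_pos

theorem lemma31_general (d : ℕ) :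
    ∃ P : Polynomial ℕ, Nondecreasing (fun n => P.eval n) ∧
      ∀ (σ : Type*) (V : VASS d σ) (S : V.Sequential) (s : Config d σ),
        s.state ∈ (S.comp 0).states → V.ForwardDiagonal s →
          S.seqCone.Nonempty ∧
            ∀ c : Config d σ, V.Reachable s c →
              distToSet (fun i => (c.vec i : ℚ)) S.seqCone ≤ ((P.eval (V.sizeWith s) : ℕ) : ℝ) := by
  let X : Polynomial ℕ := Polynomial.X
  let P : Polynomial ℕ := (d + 1) * ((X + 2) * hullBound d (X + 1) + X + 1)
  have hP : ∀ n, P.eval n = (d + 1) * ((n + 2) * hullBound d (n + 1) + n + 1) := by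
    simp [P, X, hullBound]
  refine ⟨P, funext hP ▸ nondecreasing_succ_mul_add_hullBound d, fun σ V S s hs hdiag => ⟨?_, ?_⟩⟩
  · have ⟨_, _, hreach⟩ := hdiag
    obtain ⟨z, hz, -⟩ := S.exists_mem_seqCone_abs_sub_vec_le hs hdiag hreach
    exact ⟨z, hz⟩
  · intro c hc
    obtain ⟨z, hz, hzc⟩ := S.exists_mem_seqCone_abs_sub_vec_le hs hdiag hc
    refine (distToSet_le hz hzc).trans ?_
    rw [hP, hullBound, hullBound]
    push_cast
    gcongr
    linarith

theorem lemma31 :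
    ∃ P : Polynomial ℕ, Nondecreasing (fun n => P.eval n) ∧
      ∀ (σ : Type*) (V : VASS 3 σ) (S : V.Sequential) (s : Config 3 σ),
        s.state ∈ (S.comp 0).states → V.ForwardDiagonal s →
          S.seqCone.Nonempty ∧
            ∀ c : Config 3 σ, V.Reachable s c →
              distToSet (fun i => (c.vec i : ℚ)) S.seqCone ≤ ((P.eval (V.sizeWith s) : ℕ) : ℝ) :=
  lemma31_general 3
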